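/- Let $P_{-2,n}(c)$, $n\ge 0$, be the polynomials in $c$ determined by $P_{-2,0}=P_{-2,1}=P_{-2,3}=0$, $P_{-2,2}=1$ and $$(6+2k)\,P_{-2,k+4}(c)=4k\,c\,P_{-2,k+2}(c)-2(k-3)\,P_{-2,k}(c),\qquad k\ge 0,$$ and put $\bar q_n(c)=P_{-2,2n+6}(c)$ for $n\ge 0$. Then, with $\bar q_{-1}:=0$, $$4(n+2)\,c\,\bar q_n=(2n+7)\,\bar q_{n+1}+(2n+1)\,\bar q_{n-1},\qquad n\ge 0,$$ each $\bar q_n$ has degree exactly $n$, and the polynomials $\bar q_n$ are orthogonal with respect to some weight function: there is a nonnegative function $w$ on $\mathbb R$ with $\int_{\mathbb R} w(x)\,dx>0$, all of whose moments $\int_{\mathbb R}x^k w(x)\,dx$, $k\ge 0$, converge absolutely, such that $$\int_{\mathbb R}\bar q_m(x)\,\bar q_n(x)\,w(x)\,dx=0\quad (m\ne n),\qquad \int_{\mathbb R}\bar q_n(x)^2\,w(x)\,dx>0\quad (n\ge 0).$$ -/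

import Mathlib

open Polynomial MeasureTheory

noncomputable section

/-- The second elliptic family `P_{-2,n}(c)` of DJKM polynomials, `n ≥ 0`, in the variable `c = X`:
the coefficients of `z ^ n` in `z √(1 - 2cz² + z⁴) ∫ (z⁴ - 2cz² + 1)^(-3/2) dz`.
They are given by `P₀ = P₁ = P₃ = 0`, `P₂ = 1` and
`(6 + 2k) P_{k+4} = 4 k c P_{k+2} - 2 (k - 3) P_k` for `k ≥ 0`.
(Here the index is shifted by `4`, so that it starts at `0` rather than at `-4`.) -/
def ellipticP : ℕ → ℝ[X]
  | 0 => 0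
  | 1 => 0
  | 2 => 1
  | 3 => 0
  | (k + 4) =>
      C ((6 + 2 * (k : ℝ))⁻¹) *
        (C (4 * (k : ℝ)) * X * ellipticP (k + 2) - C (2 * ((k : ℝ) - 3)) * ellipticP k)

/-- The polynomials `q̄ₙ = P_{-2,2n+6}` (with the index starting at `-4`: `q̄ₙ = P_{-2,2n+2}`). -/
def qbar (n : ℕ) : ℝ[X] := ellipticP (2 * n + 6)

/-- A weight function on the real line: a nonnegative function, all of whose moments exist, with
positive total mass. -/
structure IsWeightFunction (w : ℝ → ℝ) : Prop where
  nonneg : ∀ x, 0 ≤ w x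
  integrable_moment : ∀ k : ℕ, Integrable (fun x => x ^ k * w x) volume
  mass_pos : 0 < ∫ x, w x

/-- `p₀, p₁, p₂, …` is a sequence of orthogonal polynomials with respect to `w`: `pₙ` has degree
exactly `n`, distinct members are orthogonal in `L²(w dx)`, and every member has positive norm. -/
structure IsOrthogonalPolynomialSequence (w : ℝ → ℝ) (p : ℕ → ℝ[X]) : Prop where
  degree_eq : ∀ n, (p n).degree = n
  orthogonal : ∀ m n, m ≠ n → ∫ x, (p m).eval x * (p n).eval x * w x = 0
  norm_pos : ∀ n, 0 < ∫ x, (p n).eval x ^ 2 * w x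

end

open Complex Set Filter Topology

/-! The weight is built explicitly from a second solution of the recurrence. For `c = cos θ`, `z =
exp (iθ)`, put `Rᵢ = z^i ∫₀¹ t^(2i) √(1-t²) √(1-z²t²) dt` (`jostSolution`). It solves the recurrence
shifted by one (`jostSolution_recurrence`), and `R₀` has no zero on the closed disc because the
integrand has positive real part there. The sequence `Im (Rᵢ / R₀)` solves the same recurrence and
vanishes at `i = 0`, so it is a multiple of `q̄ᵢ₋₁(cos θ)` (`eval_qbar_mul_jostIm`). The weight is
`w(cos θ) = Im (R₁ / R₀)`. Positivity: the Wronskian of `R` and its conjugate keeps its sign as `i`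
varies, and Laplace asymptotics make it positive for large `i` (`jostIm_one_pos`). Orthogonality: `∫
x^k q̄ₙ w` becomes the mean over the unit circle of the real part of a function analytic in the disc
that vanishes at `0` when `k < n`. -/

/-! ### The principal square root of `1 - u t²`. -/

lemma re_one_sub_mul_sq_nonneg {u : ℂ} (hu : ‖u‖ ≤ 1) {t : ℝ} (ht : t ∈ Icc (0 : ℝ) 1) :
    0 ≤ (1 - u * (t : ℂ) ^ 2).re := by
  have h1 : u.re ≤ 1 := (re_le_norm u).trans hu
  have h2 : t ^ 2 ≤ 1 := pow_le_one₀ ht.1 ht.2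
  have h3 : (1 - u * (t : ℂ) ^ 2).re = 1 - u.re * t ^ 2 := by
    simp [← ofReal_pow]
  rw [h3]
  nlinarith [sq_nonneg t]

lemma re_one_sub_mul_sq_pos {u : ℂ} (hu : ‖u‖ ≤ 1) {t : ℝ} (ht : t ∈ Ioo (0 : ℝ) 1) :
    0 < (1 - u * (t : ℂ) ^ 2).re := by
  have h1 : u.re ≤ 1 := (re_le_norm u).trans hu
  have h2 : t ^ 2 < 1 := pow_lt_one₀ ht.1.le ht.2 two_ne_zero
  have h3 : (1 - u * (t : ℂ) ^ 2).re = 1 - u.re * t ^ 2 := by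
    simp [← ofReal_pow]
  rw [h3]
  nlinarith [sq_nonneg t]

lemma norm_cpow_half (z : ℂ) : ‖z ^ (1 / 2 : ℂ)‖ = ‖z‖ ^ (1 / 2 : ℝ) := by
  rw [← norm_cpow_real]
  norm_num

lemma re_cpow_half_pos {z : ℂ} (hz : z ∈ slitPlane) : 0 < (z ^ (1 / 2 : ℂ)).re := by
  have h0 : z ≠ 0 := slitPlane_ne_zero hz
  have h : (log z * (1 / 2)).im = arg z / 2 := by
    have : log z * (1 / 2) = ((1 / 2 : ℝ) : ℂ) * log z := by push_cast; ring
    rw [this, im_ofReal_mul, log_im]; ring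
  rw [cpow_def_of_ne_zero h0, exp_re, h]
  have h1 := neg_pi_lt_arg z
  have h2 := (mem_slitPlane_iff_arg.1 hz).1
  have h3 := lt_of_le_of_ne (arg_le_pi z) h2
  exact mul_pos (Real.exp_pos _) (Real.cos_pos_of_mem_Ioo ⟨by linarith, by linarith⟩)

lemma mem_slitPlane_one_sub {u : ℂ} (hu : ‖u‖ ≤ 1) {t : ℝ} (ht : t ∈ Ioo (0 : ℝ) 1) :
    1 - u * (t : ℂ) ^ 2 ∈ slitPlane := Or.inl (re_one_sub_mul_sq_pos hu ht)

/-! ### Regularity, nonvanishing and recurrence of the integral. -/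

/-- The integrand of `jostIntegral`. -/
noncomputable def jostIntegrand (j : ℕ) (u : ℂ) (t : ℝ) : ℂ :=
  ((t ^ (2 * j) * √(1 - t ^ 2) : ℝ) : ℂ) * (1 - u * (t : ℂ) ^ 2) ^ (1 / 2 : ℂ)

/-- The analytic part of the minimal solution of the three-term recurrence. -/
noncomputable def jostIntegral (j : ℕ) (u : ℂ) : ℂ := ∫ t in (0 : ℝ)..1, jostIntegrand j u t

lemma continuousOn_cpow_half_one_sub :
    ContinuousOn (fun p : ℂ × ℝ => (1 - p.1 * (p.2 : ℂ) ^ 2) ^ (1 / 2 : ℂ))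
      {p | ‖p.1‖ ≤ 1 ∧ p.2 ∈ Icc (0 : ℝ) 1} := by
  intro p hp
  apply ContinuousAt.continuousWithinAt
  -- The base vanishes at `u = t = 1`; the power stays continuous there because its exponent has
  -- positive real part.
  have hc : ContinuousAt (fun z : ℂ => z ^ (1 / 2 : ℂ)) (1 - p.1 * (p.2 : ℂ) ^ 2) :=
    continuousAt_cpow_const_of_re_pos (Or.inl (re_one_sub_mul_sq_nonneg hp.1 hp.2)) (by norm_num)
  exact ContinuousAt.comp (f := fun p : ℂ × ℝ => 1 - p.1 * (p.2 : ℂ) ^ 2) hc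
    (Continuous.continuousAt (by fun_prop))

lemma continuousOn_cpow_half_one_sub_right {u : ℂ} (hu : ‖u‖ ≤ 1) :
    ContinuousOn (fun t : ℝ => (1 - u * (t : ℂ) ^ 2) ^ (1 / 2 : ℂ)) (Icc 0 1) :=
  continuousOn_cpow_half_one_sub.comp (f := fun t : ℝ => (u, t)) (by fun_prop)
    fun _ ht => ⟨hu, ht⟩

lemma continuousOn_jostIntegrand (j : ℕ) {u : ℂ} (hu : ‖u‖ ≤ 1) :
    ContinuousOn (jostIntegrand j u) (Icc 0 1) :=
  ContinuousOn.mul (Continuous.continuousOn (by fun_prop))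
    (continuousOn_cpow_half_one_sub_right hu)

lemma intervalIntegrable_jostIntegrand (j : ℕ) {u : ℂ} (hu : ‖u‖ ≤ 1) :
    IntervalIntegrable (jostIntegrand j u) volume 0 1 :=
  ContinuousOn.intervalIntegrable (by
    rw [uIcc_of_le zero_le_one]; exact continuousOn_jostIntegrand j hu)

lemma aestronglyMeasurable_jostIntegrand (j : ℕ) {u : ℂ} (hu : ‖u‖ ≤ 1) :
    AEStronglyMeasurable (jostIntegrand j u) (volume.restrict (uIoc 0 1)) :=
  (intervalIntegrable_iff.1 (intervalIntegrable_jostIntegrand j hu)).aestronglyMeasurable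

lemma jostCoeff_mem_Icc (j : ℕ) {t : ℝ} (ht : t ∈ Icc (0 : ℝ) 1) :
    t ^ (2 * j) * √(1 - t ^ 2) ∈ Icc (0 : ℝ) 1 := by
  have ht0 := ht.1
  have h1 : t ^ (2 * j) ≤ 1 := pow_le_one₀ ht.1 ht.2
  have h2 : √(1 - t ^ 2) ≤ 1 := by
    rw [Real.sqrt_le_one]; nlinarith [sq_nonneg t]
  exact ⟨by positivity, mul_le_one₀ h1 (Real.sqrt_nonneg _) h2⟩

lemma norm_jostIntegrand_le (j : ℕ) {u : ℂ} (hu : ‖u‖ ≤ 1) {t : ℝ} (ht : t ∈ Icc (0 : ℝ) 1) :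
    ‖jostIntegrand j u t‖ ≤ 2 := by
  have hc := jostCoeff_mem_Icc j ht
  have h1 : ‖1 - u * (t : ℂ) ^ 2‖ ≤ 2 := by
    refine (norm_sub_le _ _).trans ?_
    have : ‖u * (t : ℂ) ^ 2‖ ≤ 1 := by
      rw [norm_mul, norm_pow, norm_real, Real.norm_of_nonneg ht.1]
      exact mul_le_one₀ hu (by positivity) (pow_le_one₀ ht.1 ht.2)
    rw [norm_one]; linarith
  have h2 : ‖1 - u * (t : ℂ) ^ 2‖ ^ (1 / 2 : ℝ) ≤ 2 := by
    calc _ ≤ (2 : ℝ) ^ (1 / 2 : ℝ) := Real.rpow_le_rpow (norm_nonneg _) h1 (by norm_num)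
      _ ≤ (2 : ℝ) ^ (1 : ℝ) := Real.rpow_le_rpow_of_exponent_le (by norm_num) (by norm_num)
      _ = 2 := by norm_num
  rw [jostIntegrand, norm_mul, norm_cpow_half, norm_real, Real.norm_of_nonneg hc.1]
  calc _ ≤ 1 * (2 : ℝ) := mul_le_mul hc.2 h2 (by positivity) zero_le_one
    _ = 2 := by norm_num

lemma continuousOn_jostIntegral (j : ℕ) :
    ContinuousOn (jostIntegral j) (Metric.closedBall 0 1) := by
  intro u hu
  apply intervalIntegral.continuousWithinAt_of_dominated_interval (bound := fun _ => 2)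
  · filter_upwards [self_mem_nhdsWithin] with v hv
    exact aestronglyMeasurable_jostIntegrand j (by simpa using hv)
  · filter_upwards [self_mem_nhdsWithin] with v hv
    refine ae_of_all _ fun t ht => norm_jostIntegrand_le j (by simpa using hv) ?_
    rw [uIoc_of_le zero_le_one] at ht
    exact Ioc_subset_Icc_self ht
  · exact intervalIntegrable_const
  · refine ae_of_all _ fun t ht => ?_
    rw [uIoc_of_le zero_le_one] at ht
    have h : ContinuousOn (fun v => (1 - v * (t : ℂ) ^ 2) ^ (1 / 2 : ℂ)) (Metric.closedBall 0 1) :=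
      continuousOn_cpow_half_one_sub.comp (f := fun v : ℂ => (v, t)) (by fun_prop)
        fun v hv => ⟨by simpa using hv, Ioc_subset_Icc_self ht⟩
    exact (continuousOn_const.mul h) u hu

lemma differentiableAt_jostIntegral (j : ℕ) {u : ℂ} (hu : ‖u‖ < 1) :
    DifferentiableAt ℂ (jostIntegral j) u := by
  -- On the ball of this radius `Re (1 - v t²) ≥ ε`, which bounds the exponent `-1/2` appearing in
  -- the derivative.
  set ε : ℝ := (1 - ‖u‖) / 2 with hε
  have hε0 : 0 < ε := by linarith
  have hball : ∀ v ∈ Metric.ball u ε, ‖v‖ ≤ 1 - ε := by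
    intro v hv
    have h1 : ‖v - u‖ < ε := by simpa [dist_eq_norm] using hv
    have h2 : ‖v‖ ≤ ‖v - u‖ + ‖u‖ := by simpa using norm_add_le (v - u) u
    linarith
  have hv1 : ∀ v ∈ Metric.ball u ε, ‖v‖ ≤ 1 := fun v hv => by linarith [hball v hv]
  have hre : ∀ v ∈ Metric.ball u ε, ∀ t ∈ Icc (0 : ℝ) 1, ε ≤ (1 - v * (t : ℂ) ^ 2).re := by
    intro v hv t ht
    have h1 : v.re ≤ 1 - ε := (re_le_norm v).trans (hball v hv)
    have h2 : t ^ 2 ≤ 1 := pow_le_one₀ ht.1 ht.2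
    have h3 : (1 - v * (t : ℂ) ^ 2).re = 1 - v.re * t ^ 2 := by simp [← ofReal_pow]
    have h4 : ε ≤ 1 := by linarith [norm_nonneg u]
    rw [h3]
    nlinarith [sq_nonneg t]
  let F' : ℂ → ℝ → ℂ := fun v t => ((t ^ (2 * j) * √(1 - t ^ 2) : ℝ) : ℂ) *
    ((1 / 2 : ℂ) * (1 - v * (t : ℂ) ^ 2) ^ ((1 / 2 : ℂ) - 1) * (-(t : ℂ) ^ 2))
  have key := intervalIntegral.hasDerivAt_integral_of_dominated_loc_of_deriv_le
    (F := jostIntegrand j) (F' := F') (x₀ := u) (s := Metric.ball u ε) (a := 0) (b := 1)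
    (bound := fun _ => (1 / 2) * ε ^ (-(1 / 2) : ℝ)) (μ := volume) (Metric.ball_mem_nhds u hε0) ?_
    (intervalIntegrable_jostIntegrand j hu.le) ?_ ?_ intervalIntegrable_const ?_
  · exact key.2.differentiableAt
  · filter_upwards [Metric.ball_mem_nhds u hε0] with v hv
    exact aestronglyMeasurable_jostIntegrand j (hv1 v hv)
  · have hc : ContinuousOn (F' u) (Icc 0 1) := by
      refine ContinuousOn.mul (Continuous.continuousOn (by fun_prop)) ?_
      refine ContinuousOn.mul (continuousOn_const.mul ?_) (Continuous.continuousOn (by fun_prop))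
      refine ContinuousOn.cpow_const (Continuous.continuousOn (by fun_prop)) fun t ht => ?_
      exact Or.inl (hε0.trans_le (hre u (Metric.mem_ball_self hε0) t ht))
    have : IntervalIntegrable (F' u) volume 0 1 := by
      apply ContinuousOn.intervalIntegrable
      rwa [uIcc_of_le zero_le_one]
    exact (intervalIntegrable_iff.1 this).aestronglyMeasurable
  · refine ae_of_all _ fun t ht v hv => ?_
    rw [uIoc_of_le zero_le_one] at ht
    have ht' := Ioc_subset_Icc_self ht
    have hc := jostCoeff_mem_Icc j ht'
    have h1 : ε ≤ ‖1 - v * (t : ℂ) ^ 2‖ := (hre v hv t ht').trans (re_le_norm _)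
    have h2 : ‖(1 - v * (t : ℂ) ^ 2) ^ ((1 / 2 : ℂ) - 1)‖ ≤ ε ^ (-(1 / 2) : ℝ) := by
      have : ((1 / 2 : ℂ) - 1) = ((-(1 / 2) : ℝ) : ℂ) := by push_cast; norm_num
      rw [this, norm_cpow_real]
      exact Real.rpow_le_rpow_of_nonpos hε0 h1 (by norm_num)
    have h3 : ‖(-(t : ℂ) ^ 2)‖ ≤ 1 := by
      rw [norm_neg, norm_pow, norm_real, Real.norm_of_nonneg ht'.1]
      exact pow_le_one₀ ht'.1 ht'.2
    have h4 : ‖(1 / 2 : ℂ)‖ = 1 / 2 := by norm_num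
    simp only [F']
    rw [norm_mul, norm_mul, norm_mul, h4, norm_real, Real.norm_of_nonneg hc.1]
    calc _ ≤ 1 * (1 / 2 * ε ^ (-(1 / 2) : ℝ) * 1) := by
          gcongr
          exact hc.2
      _ = _ := by ring
  · refine ae_of_all _ fun t ht v hv => ?_
    rw [uIoc_of_le zero_le_one] at ht
    have hs : 1 - v * (t : ℂ) ^ 2 ∈ slitPlane :=
      Or.inl (hε0.trans_le (hre v hv t (Ioc_subset_Icc_self ht)))
    have hd : HasDerivAt (fun v : ℂ => 1 - v * (t : ℂ) ^ 2) (-(t : ℂ) ^ 2) v := by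
      simpa using ((hasDerivAt_id v).mul_const ((t : ℂ) ^ 2)).const_sub 1
    exact (hd.cpow_const hs).const_mul _

lemma jostIntegral_conj (j : ℕ) {u : ℂ} (hu : ‖u‖ ≤ 1) :
    jostIntegral j (starRingEnd ℂ u) = starRingEnd ℂ (jostIntegral j u) := by
  simp only [jostIntegral, intervalIntegral.integral_of_le zero_le_one]
  rw [integral_Ioc_eq_integral_Ioo, integral_Ioc_eq_integral_Ioo, ← integral_conj]
  refine setIntegral_congr_fun measurableSet_Ioo fun t ht => ?_
  have h := mem_slitPlane_iff_arg.1 (mem_slitPlane_one_sub hu ht)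
  have h2 : (1 : ℂ) - starRingEnd ℂ u * (t : ℂ) ^ 2 = starRingEnd ℂ (1 - u * (t : ℂ) ^ 2) := by
    simp
  have h3 : starRingEnd ℂ (1 / 2 : ℂ) = 1 / 2 := by simp [map_ofNat]
  simp only [jostIntegrand, map_mul, conj_ofReal]
  rw [h2, conj_cpow _ _ h.1, h3]

lemma re_jostIntegral_pos (j : ℕ) {u : ℂ} (hu : ‖u‖ ≤ 1) : 0 < (jostIntegral j u).re := by
  have h : (jostIntegral j u).re = ∫ t in (0 : ℝ)..1, (jostIntegrand j u t).re := by
    have := reCLM.intervalIntegral_comp_comm (intervalIntegrable_jostIntegrand j hu)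
    simpa [jostIntegral] using this.symm
  rw [h]
  refine intervalIntegral.intervalIntegral_pos_of_pos_on ?_ (fun t ht => ?_) zero_lt_one
  · apply ContinuousOn.intervalIntegrable
    rw [uIcc_of_le zero_le_one]
    exact continuous_re.comp_continuousOn (continuousOn_jostIntegrand j hu)
  · rw [jostIntegrand, re_ofReal_mul]
    have ht0 := ht.1
    have h1 : 0 < 1 - t ^ 2 := by
      have := pow_lt_one₀ ht.1.le ht.2 two_ne_zero
      linarith
    exact mul_pos (mul_pos (by positivity) (Real.sqrt_pos.2 h1))
      (re_cpow_half_pos (mem_slitPlane_one_sub hu ht))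

lemma jostIntegral_ne_zero (j : ℕ) {u : ℂ} (hu : ‖u‖ ≤ 1) : jostIntegral j u ≠ 0 := fun h => by
  simpa [h] using re_jostIntegral_pos j hu

lemma jostIntegral_recurrence (i : ℕ) {u : ℂ} (hu : ‖u‖ ≤ 1) :
    (2 * i + 1) * jostIntegral i u + (2 * i + 7) * u * jostIntegral (i + 2) u =
      (2 * i + 4) * (1 + u) * jostIntegral (i + 1) u := by
  have hint := fun j => intervalIntegrable_jostIntegrand j hu
  -- `H = t^(2i+1) (1-t²)^(3/2) (1-ut²)^(3/2)` vanishes at both ends; expanding its derivative in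
  -- powers of `t²` gives the three terms.
  set H : ℝ → ℂ := fun t => ((t ^ (2 * i + 1) * ((1 - t ^ 2) * √(1 - t ^ 2)) : ℝ) : ℂ) *
    ((1 - u * (t : ℂ) ^ 2) * (1 - u * (t : ℂ) ^ 2) ^ (1 / 2 : ℂ)) with hH
  have hI : ∫ t in (0 : ℝ)..1, ((2 * i + 1) * jostIntegrand i u t +
      (2 * i + 7) * u * jostIntegrand (i + 2) u t -
      (2 * i + 4) * (1 + u) * jostIntegrand (i + 1) u t) = H 1 - H 0 := by
    apply intervalIntegral.integral_eq_sub_of_hasDerivAt_of_le zero_le_one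
    · refine ContinuousOn.mul (Continuous.continuousOn (by fun_prop)) ?_
      exact ContinuousOn.mul (Continuous.continuousOn (by fun_prop))
        (continuousOn_cpow_half_one_sub_right hu)
    · intro t ht
      have h1 : 0 < 1 - t ^ 2 := by
        have := pow_lt_one₀ ht.1.le ht.2 two_ne_zero
        linarith
      have hs := mem_slitPlane_one_sub hu ht
      have hA : HasDerivAt (fun t : ℝ => 1 - t ^ 2) (-(2 * t)) t := by
        simpa using (hasDerivAt_pow 2 t).const_sub 1
      have hsq := hA.sqrt h1.ne'
      have hr := ((hasDerivAt_pow (2 * i + 1) t).mul (hA.mul hsq)).ofReal_comp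
      have hB : HasDerivAt (fun t : ℝ => 1 - u * (t : ℂ) ^ 2) (-(u * (2 * t))) t := by
        have := ((hasDerivAt_pow 2 (t : ℂ)).const_mul u).const_sub 1 |>.comp_ofReal
        simpa using this
      have hS : HasDerivAt (fun t : ℝ => (1 - u * (t : ℂ) ^ 2) ^ (1 / 2 : ℂ))
          ((1 / 2) * (1 - u * (t : ℂ) ^ 2) ^ ((1 / 2 : ℂ) - 1) * (-(u * (2 * t)))) t := by
        exact (hasStrictDerivAt_cpow_const hs).hasDerivAt.comp t hB
      have hfin := hr.mul (hB.mul hS)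
      refine hfin.congr_deriv ?_
      rw [cpow_sub _ _ (slitPlane_ne_zero hs), cpow_one]
      have hz := slitPlane_ne_zero hs
      have e2 : (1 - u * (t : ℂ) ^ 2) * (1 / 2 * ((1 - u * (t : ℂ) ^ 2) ^ (1 / 2 : ℂ) /
          (1 - u * (t : ℂ) ^ 2)) * -(u * (2 * (t : ℂ)))) =
          -(u * t) * (1 - u * (t : ℂ) ^ 2) ^ (1 / 2 : ℂ) := by
        field_simp
      have hq : √(1 - t ^ 2) ≠ 0 := (Real.sqrt_pos.2 h1).ne'
      have hsqrt : (-(2 * t)) / (2 * √(1 - t ^ 2)) * (1 - t ^ 2) = - t * √(1 - t ^ 2) := by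
        field_simp
        rw [Real.sq_sqrt h1.le]
      have e1 : (-(2 * t) * √(1 - t ^ 2) + (1 - t ^ 2) * (-(2 * t) / (2 * √(1 - t ^ 2)))) =
          -(3 * t) * √(1 - t ^ 2) := by linarith
      simp only [Pi.mul_apply]
      rw [e1, e2]
      simp only [jostIntegrand]
      generalize (1 - u * (t : ℂ) ^ 2) ^ (1 / 2 : ℂ) = S
      generalize √(1 - t ^ 2) = q
      push_cast
      ring
    · exact (((hint i).const_mul _).add ((hint (i + 2)).const_mul _)).sub
        ((hint (i + 1)).const_mul _)
  rw [intervalIntegral.integral_sub (((hint i).const_mul _).add ((hint (i + 2)).const_mul _))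
    ((hint (i + 1)).const_mul _), intervalIntegral.integral_add ((hint i).const_mul _)
    ((hint (i + 2)).const_mul _)] at hI
  simp only [intervalIntegral.integral_const_mul] at hI
  have h0 : H 1 - H 0 = 0 := by simp [hH]
  rw [h0] at hI
  exact sub_eq_zero.1 hI

/-! ### Recurrence and degree of the polynomials. -/

lemma ellipticP_recurrence (k : ℕ) :
    C (6 + 2 * (k : ℝ)) * ellipticP (k + 4) =
      C (4 * (k : ℝ)) * X * ellipticP (k + 2) - C (2 * ((k : ℝ) - 3)) * ellipticP k := by
  have h : (6 + 2 * (k : ℝ)) ≠ 0 := by positivity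
  rw [ellipticP, ← mul_assoc, ← C_mul, mul_inv_cancel₀ h, C_1, one_mul]

lemma ellipticP_four : ellipticP 4 = 0 := by
  simp [ellipticP]

lemma qbar_zero : qbar 0 = C (1 / 5) := by
  have h : qbar 0 = ellipticP (2 + 4) := rfl
  rw [h, ellipticP, show 2 + 2 = 4 from rfl, ellipticP_four, ellipticP]
  simp only [mul_zero, zero_sub, mul_one, ← C_neg, ← C_mul]
  norm_num

/-- Keeping `ellipticP (2 * n + 4)` in place of `qbar (n - 1)` covers `n = 0` too, where this term
is `ellipticP 4 = 0`. -/
lemma qbar_recurrence_aux (n : ℕ) :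
    C (2 * (n : ℝ) + 7) * qbar (n + 1) =
      C (4 * ((n : ℝ) + 2)) * X * qbar n - C (2 * (n : ℝ) + 1) * ellipticP (2 * n + 4) := by
  have h := ellipticP_recurrence (2 * n + 4)
  have h2 : C (2 : ℝ) ≠ 0 := by simp
  apply mul_left_cancel₀ h2
  have e1 : qbar (n + 1) = ellipticP (2 * n + 4 + 4) := rfl
  have e2 : qbar n = ellipticP (2 * n + 4 + 2) := rfl
  rw [e1, e2, mul_sub, ← mul_assoc, ← mul_assoc, ← mul_assoc, ← mul_assoc, ← C_mul, ← C_mul,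
    ← C_mul]
  convert h using 3 <;> (try congr 1) <;> push_cast <;> ring_nf

lemma qbar_recurrence (n : ℕ) :
    C (4 * (((n + 1 : ℕ) : ℝ) + 2)) * X * qbar (n + 1) =
      C (2 * ((n + 1 : ℕ) : ℝ) + 7) * qbar (n + 2) + C (2 * ((n + 1 : ℕ) : ℝ) + 1) * qbar n := by
  rw [qbar_recurrence_aux (n + 1)]
  exact (sub_add_cancel _ _).symm

lemma qbar_one : 8 * X * qbar 0 = 7 * qbar 1 := by
  have h := qbar_recurrence_aux 0
  rw [show 2 * 0 + 4 = 4 from rfl, ellipticP_four] at h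
  norm_num at h
  exact h.symm

lemma degree_qbar (n : ℕ) : (qbar n).degree = n := by
  have key : ∀ n : ℕ, (qbar n).degree = n ∧ (qbar (n + 1)).degree = (n + 1 : ℕ) := by
    intro n
    induction n with
    | zero =>
      have h0 : (qbar 0).degree = 0 := by rw [qbar_zero]; exact degree_C (by norm_num)
      refine ⟨h0, ?_⟩
      have h := congrArg degree qbar_one
      have c8 : (8 : ℝ[X]) = C 8 := rfl
      have c7 : (7 : ℝ[X]) = C 7 := rfl
      rw [c8, c7, degree_C_mul (by norm_num), degree_mul, degree_mul, degree_C (by norm_num),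
        degree_X, h0] at h
      simpa using h.symm
    | succ n ih =>
      refine ⟨ih.2, ?_⟩
      have hA : (C (4 * (((n + 1 : ℕ) : ℝ) + 2)) * X * qbar (n + 1)).degree =
          ((n + 2 : ℕ) : WithBot ℕ) := by
        rw [degree_mul, degree_mul, degree_C (by positivity), degree_X, ih.2]
        norm_cast
        ring
      have hB : (C (2 * ((n + 1 : ℕ) : ℝ) + 1) * qbar n).degree = ((n : ℕ) : WithBot ℕ) := by
        rw [degree_C_mul (by positivity), ih.1]
      have h := qbar_recurrence n
      rw [← sub_eq_iff_eq_add] at h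
      have h2 := congrArg degree h
      rw [degree_sub_eq_left_of_degree_lt, hA, degree_C_mul (by positivity)] at h2
      · exact h2.symm
      · rw [hA, hB]
        exact_mod_cast (by omega : n < n + 2)
  exact (key n).1

/-! ### The minimal solution on the circle and its link with `qbar`. -/

/-- The minimal solution of the three-term recurrence on the unit circle. -/
noncomputable def jostSolution (i : ℕ) (z : ℂ) : ℂ := z ^ i * jostIntegral i (z ^ 2)

lemma norm_sq_le_one {z : ℂ} (hz : ‖z‖ ≤ 1) : ‖z ^ 2‖ ≤ 1 := by
  rw [norm_pow]; exact pow_le_one₀ (norm_nonneg _) hz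

lemma jostSolution_recurrence (i : ℕ) (θ : ℝ) :
    (4 * (i + 2) * Real.cos θ : ℝ) * jostSolution (i + 1) (exp (θ * I)) =
      (2 * i + 7 : ℝ) * jostSolution (i + 2) (exp (θ * I)) +
        (2 * i + 1 : ℝ) * jostSolution i (exp (θ * I)) := by
  set z := exp (θ * I) with hz
  have hn : ‖z‖ = 1 := norm_exp_ofReal_mul_I θ
  have h := jostIntegral_recurrence i (norm_sq_le_one hn.le)
  have hcos : (2 * Real.cos θ : ℂ) * z = z ^ 2 + 1 := by
    rw [ofReal_cos, two_cos, hz, add_mul, ← exp_add, ← exp_add, ← exp_nat_mul]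
    congr 1
    · congr 1; push_cast; ring
    · simp
  simp only [jostSolution]
  push_cast at *
  calc _ = (2 * cos θ * z) * (2 * i + 4) * z ^ i * jostIntegral (i + 1) (z ^ 2) := by ring
    _ = z ^ i * ((2 * i + 4) * (1 + z ^ 2) * jostIntegral (i + 1) (z ^ 2)) := by rw [hcos]; ring
    _ = _ := by rw [← h]; ring

lemma jostSolution_zero_ne_zero {z : ℂ} (hz : ‖z‖ ≤ 1) : jostSolution 0 z ≠ 0 := by
  simpa [jostSolution] using jostIntegral_ne_zero 0 (norm_sq_le_one hz)

/-- The boundary values `Im (Rᵢ / R₀)` of the normalized minimal solution. -/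
noncomputable def jostIm (i : ℕ) (θ : ℝ) : ℝ :=
  (jostSolution i (exp (θ * I)) / jostSolution 0 (exp (θ * I))).im

lemma jostIm_zero (θ : ℝ) : jostIm 0 θ = 0 := by
  have h := jostSolution_zero_ne_zero (norm_exp_ofReal_mul_I θ).le
  simp [jostIm, div_self h]

lemma jostIm_recurrence (i : ℕ) (θ : ℝ) :
    4 * (i + 2) * Real.cos θ * jostIm (i + 1) θ =
      (2 * i + 7) * jostIm (i + 2) θ + (2 * i + 1) * jostIm i θ := by
  have h := congrArg (fun w => (w / jostSolution 0 (exp (θ * I))).im) (jostSolution_recurrence i θ)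
  simp only [add_div, mul_div_assoc, add_im, im_ofReal_mul] at h
  exact h

/-- Both sides solve the same second-order recurrence with the same initial data; the factor `5`
normalizes `q̄₀ = 1/5`. -/
lemma eval_qbar_mul_jostIm (n : ℕ) (θ : ℝ) :
    5 * (qbar n).eval (Real.cos θ) * jostIm 1 θ = jostIm (n + 1) θ := by
  have key : ∀ n : ℕ, 5 * (qbar n).eval (Real.cos θ) * jostIm 1 θ = jostIm (n + 1) θ ∧
      5 * (qbar (n + 1)).eval (Real.cos θ) * jostIm 1 θ = jostIm (n + 2) θ := by
    intro n
    induction n with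
    | zero =>
      have h0 : 5 * (qbar 0).eval (Real.cos θ) = 1 := by rw [qbar_zero]; norm_num
      refine ⟨by rw [h0, one_mul], ?_⟩
      have h1 := congrArg (eval (Real.cos θ)) qbar_one
      have h2 := jostIm_recurrence 0 θ
      simp only [eval_mul, eval_X, eval_ofNat, Nat.cast_zero, jostIm_zero] at h1 h2
      simp only [zero_add] at *
      linear_combination (-5 / 7) * jostIm 1 θ * h1 + (1 / 7) * h2 +
        (8 / 7) * Real.cos θ * jostIm 1 θ * h0
    | succ n ih =>
      refine ⟨ih.2, ?_⟩
      have h1 := congrArg (eval (Real.cos θ)) (qbar_recurrence n)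
      have h2 := jostIm_recurrence (n + 1) θ
      simp only [eval_mul, eval_add, eval_X, eval_C] at h1
      have h7 : (2 * ((n + 1 : ℕ) : ℝ) + 7) ≠ 0 := by positivity
      apply mul_left_cancel₀ h7
      have h3 := ih.1
      have h4 := ih.2
      linear_combination (-5) * jostIm 1 θ * h1 + h2 - (2 * ((n + 1 : ℕ) : ℝ) + 1) * h3 +
        4 * (((n + 1 : ℕ) : ℝ) + 2) * Real.cos θ * h4
  exact (key n).1

/-! ### Asymptotics of the integral for large index. -/

/-- The measure `√(1 - t²) dt`. -/
noncomputable def semicircleMeasure : Measure ℝ :=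
  volume.withDensity fun t : ℝ => ENNReal.ofReal (√(1 - t ^ 2))

instance : IsLocallyFiniteMeasure semicircleMeasure :=
  IsLocallyFiniteMeasure.withDensity_ofReal (by fun_prop)

lemma jostIntegral_eq_setIntegral (j : ℕ) (u : ℂ) :
    jostIntegral j u = ∫ t in Icc (0 : ℝ) 1,
      (t ^ 2) ^ j • (1 - u * (t : ℂ) ^ 2) ^ (1 / 2 : ℂ) ∂semicircleMeasure := by
  have hm : Measurable fun t : ℝ => ENNReal.ofReal (√(1 - t ^ 2)) := by fun_prop
  rw [semicircleMeasure, setIntegral_withDensity_eq_setIntegral_toReal_smul hm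
    (ae_of_all _ fun _ => ENNReal.ofReal_lt_top) _ measurableSet_Icc, jostIntegral,
    intervalIntegral.integral_of_le zero_le_one, integral_Icc_eq_integral_Ioc]
  refine setIntegral_congr_fun measurableSet_Ioc fun t _ => ?_
  simp only [jostIntegrand, ENNReal.toReal_ofReal (Real.sqrt_nonneg _), real_smul, ofReal_mul,
    ofReal_pow]
  ring

lemma semicircleMeasure_inter_Icc_pos {U : Set ℝ} (hU : IsOpen U) (h1 : (1 : ℝ) ∈ U) :
    0 < semicircleMeasure (U ∩ Icc 0 1) := by
  have hm : Measurable fun t : ℝ => ENNReal.ofReal (√(1 - t ^ 2)) := by fun_prop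
  refine pos_iff_ne_zero.2 fun h => ?_
  rw [semicircleMeasure, withDensity_apply_eq_zero hm] at h
  have hsub : U ∩ Ioo 0 1 ⊆ {t : ℝ | ENNReal.ofReal (√(1 - t ^ 2)) ≠ 0} ∩ (U ∩ Icc 0 1) := by
    rintro t ⟨htU, ht⟩
    refine ⟨?_, htU, Ioo_subset_Icc_self ht⟩
    have : t ^ 2 < 1 := pow_lt_one₀ ht.1.le ht.2 two_ne_zero
    exact (ENNReal.ofReal_pos.2 (Real.sqrt_pos.2 (by linarith))).ne'
  have hne : (U ∩ Ioo 0 1).Nonempty := by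
    have hcl : (1 : ℝ) ∈ closure (Ioo (0 : ℝ) 1) := by
      rw [closure_Ioo zero_ne_one]; exact right_mem_Icc.2 zero_le_one
    exact mem_closure_iff.1 hcl U hU h1
  exact ((hU.inter isOpen_Ioo).measure_pos volume hne).ne' (measure_mono_null hsub h)

/-- Laplace's principle: the normalized powers of `t²` concentrate at their maximum `t = 1`, leaving
the value of the other factor there. -/
lemma tendsto_jostIntegral_normalized {u : ℂ} (hu : ‖u‖ ≤ 1) :
    Tendsto (fun j : ℕ => (∫ t in Icc (0 : ℝ) 1, (t ^ 2) ^ j ∂semicircleMeasure)⁻¹ •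
      jostIntegral j u) atTop (𝓝 ((1 - u) ^ (1 / 2 : ℂ))) := by
  have hg := continuousOn_cpow_half_one_sub_right hu
  have h := tendsto_setIntegral_pow_smul_of_unique_maximum_of_isCompact_of_measure_nhdsWithin_pos
    (μ := semicircleMeasure) (s := Icc (0 : ℝ) 1) (x₀ := 1) (c := fun t => t ^ 2)
    (g := fun t : ℝ => (1 - u * (t : ℂ) ^ 2) ^ (1 / 2 : ℂ)) isCompact_Icc
    (fun U hU h1 => semicircleMeasure_inter_Icc_pos hU h1) (by fun_prop)
    (fun t ht hne => by
      have := lt_of_le_of_ne ht.2 hne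
      simpa using pow_lt_one₀ ht.1 this two_ne_zero)
    (fun t _ => sq_nonneg t) (by norm_num) (right_mem_Icc.2 zero_le_one)
    (hg.integrableOn_compact isCompact_Icc) (hg 1 (right_mem_Icc.2 zero_le_one))
  simp only [← jostIntegral_eq_setIntegral] at h
  simpa using h

/-! ### Positivity through the Wronskian. -/

/-- The Wronskian of the minimal solution and its complex conjugate. -/
noncomputable def jostWronskian (i : ℕ) (θ : ℝ) : ℝ :=
  (jostSolution (i + 1) (exp (θ * I)) * starRingEnd ℂ (jostSolution i (exp (θ * I)))).im

lemma jostWronskian_succ (i : ℕ) (θ : ℝ) :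
    (2 * i + 7) * jostWronskian (i + 1) θ = (2 * i + 1) * jostWronskian i θ := by
  have h := congrArg (fun w => (w * starRingEnd ℂ (jostSolution (i + 1) (exp (θ * I)))).im)
    (jostSolution_recurrence i θ)
  simp only [add_mul, mul_assoc, add_im, im_ofReal_mul, mul_conj, ofReal_im, mul_zero] at h
  simp only [jostWronskian]
  have hc : (jostSolution i (exp (θ * I)) *
      starRingEnd ℂ (jostSolution (i + 1) (exp (θ * I)))).im =
      -(jostSolution (i + 1) (exp (θ * I)) * starRingEnd ℂ (jostSolution i (exp (θ * I)))).im := by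
    simp only [mul_im, conj_re, conj_im]; ring
  rw [hc] at h
  linarith

lemma jostWronskian_eq (i : ℕ) (θ : ℝ) :
    jostWronskian i θ = (exp (θ * I) * (jostIntegral (i + 1) (exp (θ * I) ^ 2) *
      starRingEnd ℂ (jostIntegral i (exp (θ * I) ^ 2)))).im := by
  have hn : exp (θ * I) * starRingEnd ℂ (exp (θ * I)) = 1 := by
    rw [mul_conj, normSq_eq_norm_sq, norm_exp_ofReal_mul_I]; norm_num
  rw [jostWronskian, jostSolution, jostSolution, map_mul, map_pow]
  congr 1
  generalize starRingEnd ℂ (jostIntegral i (exp (θ * I) ^ 2)) = G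
  generalize starRingEnd ℂ (exp (θ * I)) = y at hn ⊢
  calc _ = (exp (θ * I) * y) ^ i *
        (exp (θ * I) * (jostIntegral (i + 1) (exp (θ * I) ^ 2) * G)) := by ring
    _ = _ := by rw [hn, one_pow, one_mul]

/-- After positive normalization the Wronskian tends to `sin θ · |1 - z²|`, which is positive on
`(0, π)`. -/
lemma exists_jostWronskian_pos {θ : ℝ} (hθ : θ ∈ Ioo 0 Real.pi) : ∃ i, 0 < jostWronskian i θ := by
  set z := exp (θ * I) with hz
  have hn : ‖z‖ = 1 := norm_exp_ofReal_mul_I θ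
  have hu := norm_sq_le_one hn.le
  have hsin : z.im = Real.sin θ := exp_ofReal_mul_I_im θ
  have hsin0 : 0 < Real.sin θ := Real.sin_pos_of_pos_of_lt_pi hθ.1 hθ.2
  have h := tendsto_jostIntegral_normalized hu
  have h1 := (h.comp (tendsto_add_atTop_nat 1)).mul ((continuous_conj.tendsto _).comp h)
  have h2 := (continuous_im.tendsto _).comp (h1.const_mul z)
  have hne : 1 - z ^ 2 ≠ 0 := by
    intro h0
    have h3 : (z - 1) * (z + 1) = 0 := by linear_combination -h0
    rcases mul_eq_zero.1 h3 with h4 | h4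
    · have := congrArg im h4; simp [hsin] at this; linarith
    · have := congrArg im h4; simp [hsin] at this; linarith
  have hpos : 0 < (z * ((1 - z ^ 2) ^ (1 / 2 : ℂ) *
      starRingEnd ℂ ((1 - z ^ 2) ^ (1 / 2 : ℂ)))).im := by
    rw [mul_conj, im_mul_ofReal, hsin]
    refine mul_pos hsin0 (normSq_pos.2 fun h0 => hne ?_)
    exact ((cpow_eq_zero_iff _ _).1 h0).1
  obtain ⟨i, hi⟩ := (h2.eventually (lt_mem_nhds hpos)).exists
  refine ⟨i, ?_⟩
  set b : ℕ → ℝ := fun j => ∫ t in Icc (0 : ℝ) 1, (t ^ 2) ^ j ∂semicircleMeasure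
  have hb : ∀ j, 0 ≤ (b j)⁻¹ := fun j =>
    inv_nonneg.2 (setIntegral_nonneg measurableSet_Icc fun t _ => by positivity)
  have hi' : 0 < (b (i + 1))⁻¹ * (b i)⁻¹ * jostWronskian i θ := by
    have hi₁ : 0 < (z * (((b (i + 1))⁻¹ • jostIntegral (i + 1) (z ^ 2)) *
        starRingEnd ℂ ((b i)⁻¹ • jostIntegral i (z ^ 2)))).im := hi
    have e : z * (((b (i + 1))⁻¹ • jostIntegral (i + 1) (z ^ 2)) *
        starRingEnd ℂ ((b i)⁻¹ • jostIntegral i (z ^ 2))) =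
        (((b (i + 1))⁻¹ * (b i)⁻¹ : ℝ) : ℂ) *
          (z * (jostIntegral (i + 1) (z ^ 2) * starRingEnd ℂ (jostIntegral i (z ^ 2)))) := by
      simp only [real_smul, map_mul, conj_ofReal, ofReal_mul]
      ring
    rwa [e, im_ofReal_mul, ← jostWronskian_eq] at hi₁
  exact pos_of_mul_pos_right hi' (mul_nonneg (hb _) (hb _))

lemma jostWronskian_zero_pos {θ : ℝ} (hθ : θ ∈ Ioo 0 Real.pi) : 0 < jostWronskian 0 θ := by
  obtain ⟨i, hi⟩ := exists_jostWronskian_pos hθ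
  induction i with
  | zero => exact hi
  | succ i ih =>
    refine ih (pos_of_mul_pos_right (a := 2 * (i : ℝ) + 1) ?_ (by positivity))
    rw [← jostWronskian_succ]
    positivity

lemma jostIm_one_pos {θ : ℝ} (hθ : θ ∈ Ioo 0 Real.pi) : 0 < jostIm 1 θ := by
  have h0 := jostSolution_zero_ne_zero (norm_exp_ofReal_mul_I θ).le
  have h : jostIm 1 θ = (normSq (jostSolution 0 (exp (θ * I))))⁻¹ * jostWronskian 0 θ := by
    rw [jostIm, jostWronskian, div_eq_mul_inv, inv_def, ← mul_assoc, im_mul_ofReal, mul_comm]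
  rw [h]
  exact mul_pos (inv_pos.2 (normSq_pos.2 h0)) (jostWronskian_zero_pos hθ)

/-! ### Orthogonality in the variable `θ`. -/

lemma continuous_jostIm (i : ℕ) : Continuous (jostIm i) := by
  have hs : ∀ j, Continuous fun θ : ℝ => jostSolution j (exp (θ * I)) := by
    intro j
    have h : Continuous fun θ : ℝ => jostIntegral j (exp (θ * I) ^ 2) :=
      (continuousOn_jostIntegral j).comp_continuous (by fun_prop) fun θ => by simp
    exact Continuous.mul (by fun_prop) h
  exact continuous_im.comp ((hs i).div (hs 0) fun θ =>
    jostSolution_zero_ne_zero (norm_exp_ofReal_mul_I θ).le)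

lemma jostIm_two_pi_sub (i : ℕ) (θ : ℝ) : jostIm i (2 * Real.pi - θ) = -jostIm i θ := by
  have hz : exp (((2 * Real.pi - θ : ℝ) : ℂ) * I) = starRingEnd ℂ (exp (θ * I)) := by
    rw [← exp_conj, map_mul, conj_ofReal, conj_I]
    push_cast
    rw [sub_mul, exp_sub, exp_two_pi_mul_I, one_div, ← exp_neg]
    congr 1; ring
  have hs : ∀ j, jostSolution j (starRingEnd ℂ (exp (θ * I))) =
      starRingEnd ℂ (jostSolution j (exp (θ * I))) := by
    intro j
    simp only [jostSolution, ← map_pow, map_mul]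
    rw [jostIntegral_conj j (norm_sq_le_one (norm_exp_ofReal_mul_I θ).le)]
  rw [jostIm, hz, hs, hs, ← map_div₀, conj_im, jostIm]

lemma diffContOnCl_jostIntegral_sq (j : ℕ) :
    DiffContOnCl ℂ (fun z => jostIntegral j (z ^ 2)) (Metric.ball 0 1) := by
  refine ⟨fun z hz => ?_, ?_⟩
  · have hz' : ‖z ^ 2‖ < 1 := by
      rw [norm_pow]
      exact pow_lt_one₀ (norm_nonneg _) (by simpa using hz) two_ne_zero
    exact (DifferentiableAt.comp z (differentiableAt_jostIntegral j hz')
      (by fun_prop)).differentiableWithinAt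
  · rw [closure_ball _ one_ne_zero]
    refine (continuousOn_jostIntegral j).comp (by fun_prop) fun z hz => ?_
    simpa using norm_sq_le_one (by simpa using hz)

lemma integral_cos_pow_mul_sin_mul_jostIm_two_pi {k n : ℕ} (hk : k < n) :
    ∫ θ in (0 : ℝ)..2 * Real.pi, Real.cos θ ^ k * Real.sin θ * jostIm (n + 1) θ = 0 := by
  -- On the circle `Φ = i cos^k θ sin θ R_{n+1} / R₀`: cosine and sine cost `z^(k+1)` out of the
  -- `z^(n+1)` in `R_{n+1}`, so `z^(n-k)` remains.
  set Φ : ℂ → ℂ := fun z => ((z ^ 2 + 1) / 2) ^ k * ((z ^ 2 - 1) / 2) * z ^ (n - k) *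
    (jostIntegral (n + 1) (z ^ 2) * (jostIntegral 0 (z ^ 2))⁻¹) with hΦ
  have hd : DiffContOnCl ℂ Φ (Metric.ball 0 |1|) := by
    rw [abs_one]
    have hp : DiffContOnCl ℂ
        (fun z : ℂ => ((z ^ 2 + 1) / 2) ^ k * ((z ^ 2 - 1) / 2) * z ^ (n - k))
        (Metric.ball 0 1) := Differentiable.diffContOnCl (by fun_prop)
    refine hp.smul ((diffContOnCl_jostIntegral_sq (n + 1)).smul
      ((diffContOnCl_jostIntegral_sq 0).inv fun z hz => ?_))
    rw [closure_ball _ one_ne_zero] at hz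
    exact jostIntegral_ne_zero 0 (norm_sq_le_one (by simpa using hz))
  have hcm : ∀ θ : ℝ, circleMap 0 1 θ = exp (θ * I) := fun θ => by simp [circleMap]
  have hpt : ∀ θ : ℝ, (Φ (circleMap 0 1 θ)).re =
      -(Real.cos θ ^ k * Real.sin θ * jostIm (n + 1) θ) := by
    intro θ
    have hI := I_sq
    rw [hcm]
    set z := exp (θ * I) with hz
    have hz1 : z * exp (-(θ * I)) = 1 := by rw [hz, ← exp_add, add_neg_cancel, exp_zero]
    have hcos : (z ^ 2 + 1) / 2 = z * Real.cos θ := by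
      rw [ofReal_cos, cos, ← hz, neg_mul]; linear_combination (-1 / 2) * hz1
    have hsin : (z ^ 2 - 1) / 2 = z * (I * Real.sin θ) := by
      rw [ofReal_sin, sin, ← hz, neg_mul]
      linear_combination (1 / 2) * hz1 - (1 / 2) * z * (exp (-(θ * I)) - z) * hI
    have hpow : z ^ (n + 1) = z ^ k * z * z ^ (n - k) := by
      rw [← pow_succ, ← pow_add]; congr 1; omega
    have e : Φ z = ((Real.cos θ ^ k * Real.sin θ : ℝ) : ℂ) *
        (I * (jostSolution (n + 1) z / jostSolution 0 z)) := by
      simp only [hΦ, hcos, hsin, jostSolution, hpow, pow_zero, one_mul]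
      push_cast
      ring
    rw [e, re_ofReal_mul, I_mul_re, jostIm]
    ring
  have hΦ0 : Φ 0 = 0 := by
    have : n - k ≠ 0 := by omega
    simp [hΦ, this]
  have hav := hd.circleAverage
  rw [hΦ0, Real.circleAverage_def] at hav
  have hi0 : ∫ θ in (0 : ℝ)..2 * Real.pi, Φ (circleMap 0 1 θ) = 0 :=
    (smul_eq_zero.1 hav).resolve_left (inv_ne_zero Real.two_pi_pos.ne')
  have hint : IntervalIntegrable (fun θ => Φ (circleMap 0 1 θ)) volume 0 (2 * Real.pi) := by
    apply Continuous.intervalIntegrable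
    rw [abs_one] at hd
    refine hd.continuousOn_ball.comp_continuous (continuous_circleMap 0 1) fun θ => ?_
    simp [hcm, norm_exp_ofReal_mul_I]
  have hre := reCLM.intervalIntegral_comp_comm hint
  rw [hi0] at hre
  simp only [reCLM_apply, hpt, zero_re, intervalIntegral.integral_neg, neg_eq_zero] at hre
  exact hre

/-- The reflection `θ ↦ 2π - θ` changes the sign of both `sin` and `jostIm`, so the half-period
integral is half of the full one. -/
lemma integral_cos_pow_mul_sin_mul_jostIm {k n : ℕ} (hk : k < n) :
    ∫ θ in (0 : ℝ)..Real.pi, Real.cos θ ^ k * Real.sin θ * jostIm (n + 1) θ = 0 := by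
  set f : ℝ → ℝ := fun θ => Real.cos θ ^ k * Real.sin θ * jostIm (n + 1) θ with hf
  have hc : Continuous f := ((Real.continuous_cos.pow k).mul Real.continuous_sin).mul
    (continuous_jostIm _)
  have hsymm : ∀ θ, f (2 * Real.pi - θ) = f θ := fun θ => by
    simp only [hf, jostIm_two_pi_sub, Real.cos_two_pi_sub, Real.sin_two_pi_sub]; ring
  have h1 := intervalIntegral.integral_comp_sub_left (a := 0) (b := Real.pi) f (2 * Real.pi)
  simp only [hsymm] at h1
  rw [show 2 * Real.pi - Real.pi = Real.pi by ring, sub_zero] at h1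
  have h2 := intervalIntegral.integral_add_adjacent_intervals
    (hc.intervalIntegrable (μ := volume) 0 Real.pi) (hc.intervalIntegrable Real.pi (2 * Real.pi))
  rw [integral_cos_pow_mul_sin_mul_jostIm_two_pi hk] at h2
  linarith

/-! ### The weight on the real line and the conclusion. -/

/-- The orthogonality weight of the polynomials `q̄ₙ`, supported on `[-1, 1]`. -/
noncomputable def jostWeight : ℝ → ℝ :=
  (Icc (-1) 1).indicator fun x => jostIm 1 (Real.arccos x)

lemma continuous_jostIm_arccos : Continuous fun x => jostIm 1 (Real.arccos x) :=
  (continuous_jostIm 1).comp Real.continuous_arccos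

lemma jostWeight_pos {x : ℝ} (hx : x ∈ Ioo (-1) 1) : 0 < jostWeight x := by
  rw [jostWeight, indicator_of_mem (Ioo_subset_Icc_self hx)]
  refine jostIm_one_pos ⟨Real.arccos_pos.2 hx.2, ?_⟩
  refine lt_of_le_of_ne (Real.arccos_le_pi x) fun h => ?_
  have := Real.arccos_eq_pi.1 h
  linarith [hx.1]

lemma jostWeight_nonneg (x : ℝ) : 0 ≤ jostWeight x := by
  -- The endpoints follow from the open interval by continuity.
  have hcl : Icc (-1 : ℝ) 1 ⊆ {x | 0 ≤ jostIm 1 (Real.arccos x)} := by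
    rw [← closure_Ioo (by norm_num : (-1 : ℝ) ≠ 1)]
    refine closure_minimal (fun y hy => ?_)
      (isClosed_le continuous_const continuous_jostIm_arccos)
    have := jostWeight_pos hy
    rw [jostWeight, indicator_of_mem (Ioo_subset_Icc_self hy)] at this
    exact this.le
  exact indicator_nonneg (fun y hy => hcl hy) x

lemma mul_jostWeight_eq_indicator (g : ℝ → ℝ) : (fun x => g x * jostWeight x) =
    (Icc (-1) 1).indicator fun x => g x * jostIm 1 (Real.arccos x) :=
  funext fun _ => (indicator_mul_right _ _ _).symm

lemma integrable_mul_jostWeight {g : ℝ → ℝ} (hg : Continuous g) :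
    Integrable fun x => g x * jostWeight x := by
  rw [mul_jostWeight_eq_indicator, integrable_indicator_iff measurableSet_Icc]
  exact (hg.mul continuous_jostIm_arccos).continuousOn.integrableOn_compact isCompact_Icc

lemma integral_mul_jostWeight_pos {g : ℝ → ℝ} (hg : Continuous g) (h0 : ∀ x, 0 ≤ g x)
    (hfin : {x | g x = 0}.Finite) : 0 < ∫ x, g x * jostWeight x := by
  rw [integral_pos_iff_support_of_nonneg (fun x => mul_nonneg (h0 x) (jostWeight_nonneg x))
    (integrable_mul_jostWeight hg)]
  have hsub : Ioo (-1 : ℝ) 1 \ {x | g x = 0} ⊆ Function.support fun x => g x * jostWeight x :=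
    fun x hx => mul_ne_zero hx.2 (jostWeight_pos hx.1).ne'
  refine lt_of_lt_of_le ?_ (measure_mono hsub)
  rw [measure_sdiff_null (hfin.measure_zero _)]
  simp

lemma integral_mul_jostWeight {g : ℝ → ℝ} (hg : Continuous g) :
    ∫ x, g x * jostWeight x =
      ∫ θ in (0 : ℝ)..Real.pi, g (Real.cos θ) * jostIm 1 θ * Real.sin θ := by
  rw [mul_jostWeight_eq_indicator, integral_indicator measurableSet_Icc,
    integral_Icc_eq_integral_Ioc, ← intervalIntegral.integral_of_le (by norm_num)]
  have h := intervalIntegral.integral_comp_mul_deriv (a := 0) (b := Real.pi)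
    (fun x _ => Real.hasDerivAt_cos x) (by fun_prop) (hg.mul continuous_jostIm_arccos)
  rw [Real.cos_zero, Real.cos_pi, intervalIntegral.integral_symm (-1), ← neg_eq_iff_eq_neg,
    ← intervalIntegral.integral_neg] at h
  refine h.symm.trans ?_
  refine intervalIntegral.integral_congr fun θ hθ => ?_
  rw [uIcc_of_le Real.pi_pos.le] at hθ
  simp only [Function.comp, Pi.mul_apply, Real.arccos_cos hθ.1 hθ.2]
  ring

lemma integral_pow_mul_qbar_mul_jostWeight {k n : ℕ} (hk : k < n) :
    ∫ x, x ^ k * (qbar n).eval x * jostWeight x = 0 := by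
  rw [integral_mul_jostWeight (g := fun x => x ^ k * (qbar n).eval x)
    ((continuous_pow k).mul (qbar n).continuous)]
  have h := integral_cos_pow_mul_sin_mul_jostIm hk
  refine (mul_eq_zero_iff_left (by norm_num : (5 : ℝ) ≠ 0)).1 ?_
  rw [← intervalIntegral.integral_const_mul]
  refine (intervalIntegral.integral_congr fun θ _ => ?_).trans h
  simp only [← eval_qbar_mul_jostIm n θ]
  ring

lemma integral_eval_mul_qbar_mul_jostWeight {p : ℝ[X]} {n : ℕ} (hp : p.natDegree < n) :
    ∫ x, p.eval x * (qbar n).eval x * jostWeight x = 0 := by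
  have h : ∀ x, p.eval x * (qbar n).eval x * jostWeight x =
      ∑ k ∈ Finset.range n, p.coeff k * (x ^ k * (qbar n).eval x * jostWeight x) := by
    intro x
    rw [eval_eq_sum_range' hp, Finset.sum_mul, Finset.sum_mul]
    exact Finset.sum_congr rfl fun k _ => by ring
  simp only [h]
  rw [integral_finsetSum]
  · refine Finset.sum_eq_zero fun k hk => ?_
    rw [integral_const_mul, integral_pow_mul_qbar_mul_jostWeight (Finset.mem_range.1 hk), mul_zero]
  · exact fun k _ => (integrable_mul_jostWeight
      ((continuous_pow k).mul (qbar n).continuous)).const_mul _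

lemma isWeightFunction_jostWeight : IsWeightFunction jostWeight where
  nonneg := jostWeight_nonneg
  integrable_moment k := integrable_mul_jostWeight (continuous_pow k)
  mass_pos := by
    simpa using integral_mul_jostWeight_pos (g := fun _ => 1) continuous_const
      (fun _ => zero_le_one) (by simp)

lemma isOrthogonalPolynomialSequence_qbar :
    IsOrthogonalPolynomialSequence jostWeight qbar where
  degree_eq := degree_qbar
  orthogonal m n hmn := by
    rcases lt_or_gt_of_ne hmn with h | h
    · exact integral_eval_mul_qbar_mul_jostWeight
        (by rwa [natDegree_eq_of_degree_eq_some (degree_qbar m)])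
    · simp only [mul_comm ((qbar m).eval _)]
      exact integral_eval_mul_qbar_mul_jostWeight
        (by rwa [natDegree_eq_of_degree_eq_some (degree_qbar n)])
  norm_pos n := by
    refine integral_mul_jostWeight_pos ((qbar n).continuous.pow 2) (fun x => sq_nonneg _) ?_
    have h0 : qbar n ≠ 0 := fun h => by simpa [h] using degree_qbar n
    refine ((qbar n).roots.toFinset.finite_toSet).subset fun x hx => ?_
    simpa [h0] using hx

theorem mainTheorem3 :
    (8 * X * qbar 0 = 7 * qbar 1 ∧
      ∀ n : ℕ, 1 ≤ n →
        C (4 * ((n : ℝ) + 2)) * X * qbar n =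
          C (2 * (n : ℝ) + 7) * qbar (n + 1) + C (2 * (n : ℝ) + 1) * qbar (n - 1)) ∧
    ∃ w : ℝ → ℝ, IsWeightFunction w ∧ IsOrthogonalPolynomialSequence w qbar := by
  refine ⟨⟨qbar_one, fun n hn => ?_⟩, jostWeight, isWeightFunction_jostWeight,
    isOrthogonalPolynomialSequence_qbar⟩
  obtain ⟨m, rfl⟩ := Nat.exists_eq_add_of_le' hn
  exact qbar_recurrence m
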